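/- For a point $p\in\mathbb{R}^2$ and a finite set $P\subset\mathbb{R}^2$, let $\mathcal{A}_p(P)\subset(-\pi,\pi]$ denote the set of angles pinned at $p$, i.e. the set of all directed angles at the vertex $p$ from the ray $pq$ to the ray $pr$, where $(q,r)$ runs over the ordered pairs of distinct points of $P\setminus\{p\}$, each angle being measured by its representative in $(-\pi,\pi]$. For a finite set $S\subset\mathbb{R}$ write $8S=\{s_1+\dots+s_8 : s_1,\dots,s_8\in S\}$. There is an absolute constant $c>0$ such that for every finite set $A\subset\mathbb{R}$ with $|A|\ge 2$ and every point $p\in A\times A$, $$|8\mathcal{A}_p(A\times A)|\ \ge\ c\,|A|^{13/5}.$$ -/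

import Mathlib

noncomputable section

attribute [local instance] Complex.finrank_real_complex_fact

/-- The directed angle at the vertex `p`, from the ray `p q` to the ray `p r`, in the plane `ℝ × ℝ`
(identified with `ℂ` and its standard Euclidean structure and orientation), as a real number in
`(-π, π]`. -/
def signedAngle (q p r : ℝ × ℝ) : ℝ :=
  (Complex.orientation.oangle
    (Complex.equivRealProd.symm q - Complex.equivRealProd.symm p)
    (Complex.equivRealProd.symm r - Complex.equivRealProd.symm p)).toReal

/-- The set of angles pinned at `p` that are determined by `P`: the angles formed at the vertex `p`
by ordered pairs of distinct points of `P`, both different from `p`. -/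
def pinnedAngles (p : ℝ × ℝ) (P : Finset (ℝ × ℝ)) : Finset ℝ :=
  (P.erase p).offDiag.image fun t => signedAngle t.1 p t.2

/-- The `k`-fold sumset `kS = {s₁ + ⋯ + s_k : s₁, …, s_k ∈ S}`. -/
def iteratedSumset (k : ℕ) (S : Finset ℝ) : Finset ℝ :=
  (Fintype.piFinset fun _ : Fin k => S).image fun s => ∑ i, s i

end

/-! The bound obtained is cubic, hence stronger than the exponent 13/5. In one quadrant at `p`,
choose coordinate sets `X < Y` (up to swapping axes) of size `n + 1`, `n = 4 * m`; up to
orientation, differences of `θ k i = arctan (y i / x k)` are pinned angles. As `X < Y`, the first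
differences `D k i = θ k (i + 1) - θ k i` increase with `k`, by steps `M k i > 0`.

Fix a column `a`. Medians select order `m` many `j`, `k` and values `t` of `M` for which the sums `θ
n j + D k a + t` are distinct: `t` fits in the gap above `D k a`, and `D k a + t` in the gap above
`θ n j` (`pow_three_le_card_of_second_differences`). There are enough `t` because two columns of `M`
agree in at most one row (`second_difference_arctan_ne`). Up to a constant, each sum uses four
angles. -/

/-! ### Medians and counting in real matrices. -/

/-- A real function on a set of `2 * m` points has a median: at least `m` of its values are at most
the median, and at least `m` are at least the median. -/
theorem exists_median {ι : Type*} (s : Finset ι) (g : ι → ℝ) {m : ℕ} (hm : 0 < m)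
    (hs : s.card = 2 * m) :
    ∃ μ : ℝ, m ≤ (s.filter fun i => g i ≤ μ).card ∧ m ≤ (s.filter fun i => μ ≤ g i).card := by
  classical
  have hne : s.Nonempty := Finset.card_pos.1 (by omega)
  obtain ⟨a, ha, hmax⟩ := s.exists_max_image g hne
  obtain ⟨b, hb, hmin⟩ :=
    (s.filter fun i => m ≤ (s.filter fun j => g j ≤ g i).card).exists_min_image g
      ⟨a, Finset.mem_filter.2 ⟨ha, by
        rw [Finset.filter_true_of_mem hmax]; omega⟩⟩
  rw [Finset.mem_filter] at hb
  refine ⟨g b, hb.2, ?_⟩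
  by_contra! hlt
  have hsplit := Finset.card_filter_add_card_filter_not (s := s) (fun i => g b ≤ g i)
  have hbig : m ≤ (s.filter fun i => ¬ g b ≤ g i).card := by omega
  -- The largest value below `g b` has at least `m` values at or below it, against the minimality of
  -- `b`.
  obtain ⟨d, hd, hdmax⟩ := (s.filter fun i => ¬ g b ≤ g i).exists_max_image g
    (Finset.card_pos.1 (by omega))
  rw [Finset.mem_filter] at hd
  refine hd.2 (hmin d (Finset.mem_filter.2 ⟨hd.1, hbig.trans (Finset.card_le_card ?_)⟩))
  intro i hi
  exact Finset.mem_filter.2 ⟨(Finset.mem_filter.1 hi).1, hdmax i hi⟩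

/-- A function on `E ⊆ I` takes at least as many values as `E` has points, up to the number of
coincidences on `I`. -/
theorem card_le_card_add_card_coincidences {I E : Finset ℕ} (hE : E ⊆ I) (g : ℕ → ℝ)
    {S : Finset ℝ} (hS : ∀ i ∈ E, g i ∈ S) :
    E.card ≤ S.card + (I.offDiag.filter fun t => g t.1 = g t.2).card := by
  classical
  -- Split `E` into first occurrences, where `g` is injective, and repetitions, each the second
  -- entry of a coincidence.
  rw [← Finset.card_filter_add_card_filter_not (s := E) (fun i => ∀ j ∈ E, g j = g i → i ≤ j)]
  refine add_le_add ?_ ?_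
  · refine Finset.card_le_card_of_injOn g (fun i hi => hS i (Finset.mem_filter.1 hi).1) ?_
    intro i hi j hj hij
    have hi' := Finset.mem_filter.1 (Finset.mem_coe.1 hi)
    have hj' := Finset.mem_filter.1 (Finset.mem_coe.1 hj)
    exact le_antisymm (hi'.2 j hj'.1 hij.symm) (hj'.2 i hi'.1 hij)
  · refine (Finset.card_le_card ?_).trans (Finset.card_image_le (f := Prod.snd))
    intro i hi
    obtain ⟨hiE, hi⟩ := Finset.mem_filter.1 hi
    push Not at hi
    obtain ⟨j, hj, hji, hlt⟩ := hi
    exact Finset.mem_image.2 ⟨(j, i), Finset.mem_filter.2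
      ⟨Finset.mem_offDiag.2 ⟨hE hj, hE hiE, hlt.ne⟩, hji⟩, rfl⟩

/-- If any two columns of a matrix agree in at most one row, then a set of entries which contains
many entries from each of `m` columns contains many values. -/
theorem card_le_four_mul_card_values {m : ℕ} (hm : 0 < m) {M : ℕ → ℕ → ℝ} {I : Finset ℕ}
    (hI : I.card = m)
    (hM : ∀ i ∈ I, ∀ j ∈ I, i ≠ j → ∀ k < 4 * m, ∀ l < 4 * m, M k i = M k j → M l i = M l j →
      k = l)
    {μ : ℝ} (hμ : ∀ i ∈ I, 2 * m ≤ ((Finset.range (4 * m)).filter fun k => M k i ≤ μ).card)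
    {S : Finset ℝ} (hS : ∀ i ∈ I, ∀ k < 4 * m, M k i ≤ μ → M k i ∈ S) :
    m ≤ 4 * S.card := by
  classical
  have h1 : ∀ k ∈ Finset.range (4 * m), (I.filter fun i => M k i ≤ μ).card ≤
      S.card + (I.offDiag.filter fun t => M k t.1 = M k t.2).card := fun k hk =>
    card_le_card_add_card_coincidences (Finset.filter_subset _ _) (M k) fun i hi =>
      hS i (Finset.mem_filter.1 hi).1 k (Finset.mem_range.1 hk) (Finset.mem_filter.1 hi).2
  have h2 := Finset.sum_le_sum h1
  rw [Finset.sum_add_distrib, Finset.sum_const, Finset.card_range, smul_eq_mul] at h2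
  have h3 : ∑ k ∈ Finset.range (4 * m), (I.filter fun i => M k i ≤ μ).card =
      ∑ i ∈ I, ((Finset.range (4 * m)).filter fun k => M k i ≤ μ).card :=
    Finset.sum_card_bipartiteAbove_eq_sum_card_bipartiteBelow (fun k i => M k i ≤ μ)
  have h4 : m * (2 * m) ≤ ∑ i ∈ I, ((Finset.range (4 * m)).filter fun k => M k i ≤ μ).card := by
    have := Finset.card_nsmul_le_sum I _ _ hμ
    rwa [hI, smul_eq_mul] at this
  -- A pair of columns contributes to at most one row.
  have h5 : ∑ k ∈ Finset.range (4 * m), (I.offDiag.filter fun t => M k t.1 = M k t.2).card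
      ≤ m * m := by
    rw [← Finset.card_biUnion]
    · refine (Finset.card_le_card (Finset.biUnion_subset.2 fun k _ =>
        Finset.filter_subset _ I.offDiag)).trans ?_
      rw [Finset.offDiag_card, hI]
      exact Nat.sub_le _ _
    · intro k hk l hl hkl
      refine Finset.disjoint_left.2 fun t ht ht' => hkl ?_
      obtain ⟨h, hk'⟩ := Finset.mem_filter.1 ht
      obtain ⟨hi, hj, hij⟩ := Finset.mem_offDiag.1 h
      exact hM _ hi _ hj hij k (Finset.mem_range.1 hk) l (Finset.mem_range.1 hl) hk'
        (Finset.mem_filter.1 ht').2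
  have h6 : m * m ≤ (4 * S.card) * m := by nlinarith
  exact Nat.le_of_mul_le_mul_right h6 hm

/-- Sums of a value, a first difference and a second difference are numerous: the second differences
are squeezed between the first differences, and these between the values in the last row. -/
theorem pow_three_le_card_of_second_differences {m : ℕ} (hm : 0 < m) {θ : ℕ → ℕ → ℝ}
    (hθ : ∀ i j, i < j → j ≤ 4 * m → ∀ k ≤ 4 * m, θ k i < θ k j)
    (hD : ∀ k l, k < l → l ≤ 4 * m → ∀ i < 4 * m,
      θ k (i + 1) - θ k i < θ l (i + 1) - θ l i)
    (hM : ∀ i j, i < j → j < 4 * m → ∀ k l, k < l → l < 4 * m →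
      (θ (k + 1) (i + 1) - θ (k + 1) i) - (θ k (i + 1) - θ k i) =
        (θ (k + 1) (j + 1) - θ (k + 1) j) - (θ k (j + 1) - θ k j) →
      (θ (l + 1) (i + 1) - θ (l + 1) i) - (θ l (i + 1) - θ l i) ≠
        (θ (l + 1) (j + 1) - θ (l + 1) j) - (θ l (j + 1) - θ l j))
    {W : Finset ℝ}
    (hW : ∀ j < 4 * m, ∀ k < 4 * m, ∀ i < 4 * m, ∀ k' < 4 * m, ∀ i' < 4 * m,
      θ (4 * m) j + (θ k (i + 1) - θ k i) +
        ((θ (k' + 1) (i' + 1) - θ (k' + 1) i') - (θ k' (i' + 1) - θ k' i')) ∈ W) :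
    m ^ 3 ≤ W.card := by
  classical
  set n := 4 * m with hn
  set D : ℕ → ℕ → ℝ := fun k i => θ k (i + 1) - θ k i with hDdef
  set M : ℕ → ℕ → ℝ := fun k i => D (k + 1) i - D k i with hMdef
  have hcard : (Finset.range n).card = 2 * (2 * m) := by rw [Finset.card_range]; omega
  have hMpos : ∀ k < n, ∀ i < n, 0 < M k i := fun k hk i hi =>
    sub_pos.2 (hD k (k + 1) (Nat.lt_succ_self k) hk i hi)
  have hMne : ∀ i < n, ∀ j < n, i ≠ j → ∀ k < n, ∀ l < n, M k i = M k j → M l i = M l j →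
      k = l := by
    have key : ∀ i j, i < j → j < n → ∀ k < n, ∀ l < n, M k i = M k j → M l i = M l j →
        k = l := by
      intro i j hij hj k hk l hl h h'
      rcases lt_trichotomy k l with hkl | hkl | hkl
      · exact absurd h' (hM i j hij hj k l hkl hl h)
      · exact hkl
      · exact absurd h (hM i j hij hj l k hkl hk h')
    intro i hi j hj hij k hk l hl h h'
    rcases lt_or_gt_of_ne hij with hij | hij
    · exact key i j hij hj k hk l hl h h'
    · exact key j i hij hi k hk l hl h.symm h'.symm
  obtain ⟨γ, hγle, hγge⟩ := exists_median (Finset.range n) (D n) (by omega : 0 < 2 * m) hcard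
  obtain ⟨I, hIsub, hI⟩ := Finset.exists_subset_card_eq ((by omega : m ≤ 2 * m).trans hγle)
  have hIn : ∀ i ∈ I, i < n := fun i hi =>
    Finset.mem_range.1 (Finset.mem_filter.1 (hIsub hi)).1
  choose μ hμle hμge using fun i =>
    exists_median (Finset.range n) (fun k => M k i) (by omega : 0 < 2 * m) hcard
  -- With the largest median, the threshold `μ a` still keeps half the entries of every column in
  -- `I`.
  obtain ⟨a, ha, hamax⟩ := I.exists_max_image μ (Finset.card_pos.1 (by omega))
  set J := (Finset.range n).filter fun j => γ ≤ D n j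
  set K := (Finset.range n).filter fun k => μ a ≤ M k a
  set S := ((Finset.range n ×ˢ I).filter fun t => M t.1 t.2 ≤ μ a).image fun t => M t.1 t.2
    with hSdef
  have hScard : m ≤ 4 * S.card := by
    refine card_le_four_mul_card_values hm hI
      (fun i hi j hj => hMne i (hIn i hi) j (hIn j hj)) (μ := μ a) ?_ ?_
    · intro i hi
      refine (hμle i).trans (Finset.card_le_card ?_)
      intro k hk
      rw [Finset.mem_filter] at hk ⊢
      exact ⟨hk.1, hk.2.trans (hamax i hi)⟩
    · intro i hi k hk hle
      exact Finset.mem_image.2 ⟨(k, i), Finset.mem_filter.2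
        ⟨Finset.mem_product.2 ⟨Finset.mem_range.2 hk, hi⟩, hle⟩, rfl⟩
  have hS : ∀ t ∈ S, 0 < t ∧ t ≤ μ a ∧ ∃ k < n, ∃ i < n, t = M k i := by
    intro t ht
    obtain ⟨⟨k, i⟩, hki, rfl⟩ := Finset.mem_image.1 ht
    obtain ⟨hki, hle⟩ := Finset.mem_filter.1 hki
    obtain ⟨hk, hi⟩ := Finset.mem_product.1 hki
    have hk' := Finset.mem_range.1 hk
    exact ⟨hMpos k hk' i (hIn i hi), hle, k, hk', i, hIn i hi, rfl⟩
  have han := hIn a ha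
  have hγa : D n a ≤ γ := (Finset.mem_filter.1 (hIsub ha)).2
  have hDmono : ∀ k l, k ≤ l → l ≤ n → D k a ≤ D l a := fun k l hkl hl => by
    rcases hkl.eq_or_lt with rfl | h
    · exact le_rfl
    · exact (hD k l h hl a han).le
  have hDpos : ∀ k ≤ n, 0 < D k a := fun k hk =>
    sub_pos.2 (hθ a (a + 1) (Nat.lt_succ_self a) han k hk)
  have hθmono : ∀ i j, i ≤ j → j ≤ n → θ n i ≤ θ n j := fun i j hij hj => by
    rcases hij.eq_or_lt with rfl | h
    · exact le_rfl
    · exact (hθ i j h hj n le_rfl).le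
  have hupper : ∀ k ∈ K, ∀ t ∈ S, D k a + t ≤ D (k + 1) a := by
    intro k hk t ht
    have h1 := (Finset.mem_filter.1 hk).2
    have h2 := (hS t ht).2.1
    have : M k a = D (k + 1) a - D k a := rfl
    linarith
  have hinj : Set.InjOn (fun u : ℕ × ℕ × ℝ => θ n u.1 + D u.2.1 a + u.2.2)
      (J ×ˢ K ×ˢ S : Finset (ℕ × ℕ × ℝ)) := by
    rintro ⟨j, k, t⟩ hu ⟨j', k', t'⟩ hu' heq
    simp only [Finset.coe_product, Set.mem_prod, Finset.mem_coe] at hu hu' heq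
    obtain ⟨hj, hk, ht⟩ := hu
    obtain ⟨hj', hk', ht'⟩ := hu'
    have lower : ∀ k ∈ K, ∀ t ∈ S, 0 < D k a + t := fun k hk t ht =>
      add_pos (hDpos k (Finset.mem_range.1 (Finset.mem_filter.1 hk).1).le) (hS t ht).1
    -- The chain is `D k a + t ≤ D (k + 1) a ≤ D n a ≤ γ ≤ D n j`.
    have upper : ∀ j ∈ J, ∀ k ∈ K, ∀ t ∈ S, θ n j + D k a + t ≤ θ n (j + 1) := by
      intro j hj k hk t ht
      have h1 := hupper k hk t ht
      have h2 := hDmono (k + 1) n (Finset.mem_range.1 (Finset.mem_filter.1 hk).1) le_rfl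
      have h3 := (Finset.mem_filter.1 hj).2
      have : D n j = θ n (j + 1) - θ n j := rfl
      linarith
    have hJn : ∀ j ∈ J, j < n := fun j hj => Finset.mem_range.1 (Finset.mem_filter.1 hj).1
    have hKn : ∀ k ∈ K, k < n := fun k hk => Finset.mem_range.1 (Finset.mem_filter.1 hk).1
    have hjj : j = j' := by
      rcases lt_trichotomy j j' with h | h | h
      · linarith [upper j hj k hk t ht, lower k' hk' t' ht', hθmono (j + 1) j' h (hJn j' hj').le]
      · exact h
      · linarith [upper j' hj' k' hk' t' ht', lower k hk t ht, hθmono (j' + 1) j h (hJn j hj).le]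
    subst hjj
    have hkk : k = k' := by
      rcases lt_trichotomy k k' with h | h | h
      · linarith [hupper k hk t ht, (hS t' ht').1, hDmono (k + 1) k' h (hKn k' hk').le]
      · exact h
      · linarith [hupper k' hk' t' ht', (hS t ht).1, hDmono (k' + 1) k h (hKn k hk).le]
    subst hkk
    have : t = t' := by linarith
    rw [this]
  have hle := Finset.card_le_card_of_injOn (t := W) _ (by
    rintro ⟨j, k, t⟩ hu
    simp only [Finset.coe_product, Set.mem_prod, Finset.mem_coe] at hu ⊢
    obtain ⟨hj, hk, ht⟩ := hu
    obtain ⟨-, -, k', hk', i', hi', rfl⟩ := hS t ht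
    exact hW j (Finset.mem_range.1 (Finset.mem_filter.1 hj).1) k
      (Finset.mem_range.1 (Finset.mem_filter.1 hk).1) a han k' hk' i' hi') hinj
  rw [Finset.card_product, Finset.card_product] at hle
  have hJ : 2 * m ≤ J.card := hγge
  have hK : 2 * m ≤ K.card := hμge a
  calc m ^ 3 = m * m * m := by ring
    _ ≤ m * m * (4 * S.card) := Nat.mul_le_mul_left _ hScard
    _ = (2 * m) * ((2 * m) * S.card) := by ring
    _ ≤ J.card * (K.card * S.card) :=
      Nat.mul_le_mul hJ (Nat.mul_le_mul_right _ hK)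
    _ ≤ W.card := hle

/-! ### Monotonicity and second differences of `arctan (y / x)`. -/

theorem hasDerivAt_arctan_div_sub {x y z : ℝ} (hx : 0 < x) (hy : 0 < y) (hz : 0 < z) :
    HasDerivAt (fun x => Real.arctan (z / x) - Real.arctan (y / x))
      ((z - y) * (y * z - x ^ 2) / ((x ^ 2 + y ^ 2) * (x ^ 2 + z ^ 2))) x := by
  have key : ∀ w : ℝ, 0 < w → HasDerivAt (fun x => Real.arctan (w / x))
      (-w / (x ^ 2 + w ^ 2)) x := by
    intro w hw
    have h := ((hasDerivAt_const x w).fun_div (hasDerivAt_id' x) hx.ne').arctan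
    refine h.congr_deriv ?_
    field_simp
    ring
  refine ((key z hz).sub (key y hy)).congr_deriv ?_
  field_simp
  ring

/-- The angle under which a vertical segment is seen increases with the distance. -/
theorem arctan_div_sub_lt {x x' y z : ℝ} (hx : 0 < x) (hxx : x < x') (hxy : x' < y) (hyz : y < z) :
    Real.arctan (z / x) - Real.arctan (y / x) < Real.arctan (z / x') - Real.arctan (y / x') := by
  have hy : 0 < y := by linarith
  have hz : 0 < z := by linarith
  have hd : ∀ u ∈ Set.Icc x x', HasDerivAt (fun x => Real.arctan (z / x) - Real.arctan (y / x))
      ((z - y) * (y * z - u ^ 2) / ((u ^ 2 + y ^ 2) * (u ^ 2 + z ^ 2))) u := fun u hu =>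
    hasDerivAt_arctan_div_sub (hx.trans_le hu.1) hy hz
  obtain ⟨u, hu, h⟩ := exists_hasDerivAt_eq_slope _ _ hxx
    (fun u hu => (hd u hu).continuousAt.continuousWithinAt)
    (fun u hu => hd u (Set.Ioo_subset_Icc_self hu))
  have hu0 : 0 < u := hx.trans hu.1
  have huy : u < y := hu.2.trans hxy
  have hpos : 0 < (z - y) * (y * z - u ^ 2) / ((u ^ 2 + y ^ 2) * (u ^ 2 + z ^ 2)) := by
    have : 0 < y * z - u ^ 2 := by nlinarith
    have : 0 < z - y := by linarith
    positivity
  rw [h] at hpos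
  have := (div_pos_iff_of_pos_right (sub_pos.2 hxx)).1 hpos
  linarith

/-- Each factor is positive and increasing: `(q - u) / (p - u) = 1 + (q - p) / (p - u)` and `(u + a)
/ (u + c) = 1 - (c - a) / (u + c)`. -/
theorem ratio_strictMono {a b c d p q u v : ℝ} (hu : 0 < u) (huv : u < v) (hvp : v < p)
    (hpq : p < q) (ha : 0 < a) (hac : a < c) (hb : 0 < b) (hbd : b < d) :
    (q - u) / (p - u) * ((u + a) / (u + c)) * ((u + b) / (u + d)) <
      (q - v) / (p - v) * ((v + a) / (v + c)) * ((v + b) / (v + d)) := by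
  have h1 : (q - u) / (p - u) < (q - v) / (p - v) := by
    rw [div_lt_div_iff₀ (by linarith) (by linarith)]
    nlinarith
  have h2 : ∀ a c : ℝ, 0 < a → a < c → (u + a) / (u + c) < (v + a) / (v + c) := by
    intro a c ha hac
    rw [div_lt_div_iff₀ (by linarith) (by linarith)]
    nlinarith
  have h3 : 0 < (q - u) / (p - u) := div_pos (by linarith) (by linarith)
  have h4 : 0 < (u + a) / (u + c) := div_pos (by linarith) (by linarith)
  have h5 : 0 < (u + b) / (u + d) := div_pos (by linarith) (by linarith)
  exact mul_lt_mul'' (mul_lt_mul'' h1 (h2 a c ha hac) h3.le h4.le) (h2 b d hb hbd)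
    (mul_pos h3 h4).le h5.le

theorem mul_ratio_eq {a b c d p q s t u : ℝ} (ha : u + a ≠ 0) (hb : u + b ≠ 0) (hc : u + c ≠ 0)
    (hd : u + d ≠ 0) (hp : p - u ≠ 0)
    (h : s * (q - u) / ((u + c) * (u + d)) = t * (p - u) / ((u + a) * (u + b))) :
    s * ((q - u) / (p - u) * ((u + a) / (u + c)) * ((u + b) / (u + d))) = t := by
  have e : s * ((q - u) / (p - u) * ((u + a) / (u + c)) * ((u + b) / (u + d))) =
      s * (q - u) / ((u + c) * (u + d)) * ((u + a) * (u + b) / (p - u)) := by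
    field_simp
  rw [e, h]
  field_simp

/-- The second differences of `arctan (y / x)` over two disjoint `y`-intervals agree on at most one
of two disjoint `x`-intervals. -/
theorem second_difference_arctan_ne {x₁ x₂ x₃ x₄ y₁ y₂ y₃ y₄ : ℝ} (h0 : 0 < x₁) (h12 : x₁ < x₂)
    (h23 : x₂ ≤ x₃) (h34 : x₃ < x₄) (hxy : x₄ < y₁) (k12 : y₁ < y₂) (k23 : y₂ ≤ y₃) (k34 : y₃ < y₄)
    (h : (Real.arctan (y₂ / x₂) - Real.arctan (y₁ / x₂)) -
        (Real.arctan (y₂ / x₁) - Real.arctan (y₁ / x₁)) =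
      (Real.arctan (y₄ / x₂) - Real.arctan (y₃ / x₂)) -
        (Real.arctan (y₄ / x₁) - Real.arctan (y₃ / x₁))) :
    (Real.arctan (y₂ / x₄) - Real.arctan (y₁ / x₄)) -
        (Real.arctan (y₂ / x₃) - Real.arctan (y₁ / x₃)) ≠
      (Real.arctan (y₄ / x₄) - Real.arctan (y₃ / x₄)) -
        (Real.arctan (y₄ / x₃) - Real.arctan (y₃ / x₃)) := by
  intro h'
  have hy₁ : 0 < y₁ := by linarith
  have hy₂ : 0 < y₂ := by linarith
  have hy₃ : 0 < y₃ := by linarith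
  have hy₄ : 0 < y₄ := by linarith
  have rolle : ∀ a b : ℝ, 0 < a → a < b → b < y₁ →
      (Real.arctan (y₂ / b) - Real.arctan (y₁ / b)) -
          (Real.arctan (y₂ / a) - Real.arctan (y₁ / a)) =
        (Real.arctan (y₄ / b) - Real.arctan (y₃ / b)) -
          (Real.arctan (y₄ / a) - Real.arctan (y₃ / a)) →
      ∃ u, a < u ∧ u < b ∧ (y₄ - y₃) * ((y₃ * y₄ - u ^ 2) / (y₁ * y₂ - u ^ 2) *
        ((u ^ 2 + y₁ ^ 2) / (u ^ 2 + y₃ ^ 2)) * ((u ^ 2 + y₂ ^ 2) / (u ^ 2 + y₄ ^ 2)))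
          = y₂ - y₁ := by
    intro a b ha hab hb hE
    have hd : ∀ u ∈ Set.Icc a b, HasDerivAt
        (fun x => (Real.arctan (y₄ / x) - Real.arctan (y₃ / x)) -
          (Real.arctan (y₂ / x) - Real.arctan (y₁ / x)))
        ((y₄ - y₃) * (y₃ * y₄ - u ^ 2) / ((u ^ 2 + y₃ ^ 2) * (u ^ 2 + y₄ ^ 2)) -
          (y₂ - y₁) * (y₁ * y₂ - u ^ 2) / ((u ^ 2 + y₁ ^ 2) * (u ^ 2 + y₂ ^ 2))) u := fun u hu =>
      (hasDerivAt_arctan_div_sub (ha.trans_le hu.1) hy₃ hy₄).fun_sub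
        (hasDerivAt_arctan_div_sub (ha.trans_le hu.1) hy₁ hy₂)
    obtain ⟨u, hu, he⟩ := exists_hasDerivAt_eq_zero hab
      (fun u hu => (hd u hu).continuousAt.continuousWithinAt) (by linarith)
      (fun u hu => hd u (Set.Ioo_subset_Icc_self hu))
    have hu0 : 0 < u := ha.trans hu.1
    have hu1 : u < y₁ := hu.2.trans hb
    have hp : 0 < y₁ * y₂ - u ^ 2 := by nlinarith
    have hpos : ∀ y : ℝ, u ^ 2 + y ^ 2 ≠ 0 := fun y => by positivity
    exact ⟨u, hu.1, hu.2, mul_ratio_eq (hpos _) (hpos _) (hpos _) (hpos _) hp.ne'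
      (sub_eq_zero.1 he)⟩
  obtain ⟨u, hu1, hu2, hu⟩ := rolle x₁ x₂ h0 h12 (by linarith) h
  obtain ⟨v, hv1, hv2, hv⟩ := rolle x₃ x₄ (by linarith) h34 hxy h'
  have hu0 : 0 < u := h0.trans hu1
  have huv : u < v := by linarith
  have hvy : v < y₁ := hv2.trans hxy
  -- Both Rolle points `u < v` give this strictly increasing ratio the same value.
  have hlt := ratio_strictMono (a := y₁ ^ 2) (b := y₂ ^ 2) (c := y₃ ^ 2) (d := y₄ ^ 2)
    (p := y₁ * y₂) (q := y₃ * y₄) (u := u ^ 2) (v := v ^ 2) (by positivity)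
    (pow_lt_pow_left₀ huv hu0.le two_ne_zero) (by nlinarith)
    (mul_lt_mul'' (k12.trans_le k23) (k23.trans_lt k34) hy₁.le hy₂.le)
    (by positivity) (pow_lt_pow_left₀ (k12.trans_le k23) hy₁.le two_ne_zero)
    (by positivity) (pow_lt_pow_left₀ (k23.trans_lt k34) hy₂.le two_ne_zero)
  have := mul_lt_mul_of_pos_left hlt (sub_pos.2 k34)
  linarith

/-! ### From arctangents to pinned angles and their sums. -/

noncomputable section
attribute [local instance] Complex.finrank_real_complex_fact

theorem arg_eq_arctan {z : ℂ} (hz : 0 < z.re) : z.arg = Real.arctan (z.im / z.re) := by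
  have h := abs_lt.1 (Complex.abs_arg_lt_pi_div_two_iff.2 (Or.inl hz))
  rw [← Complex.tan_arg, Real.arctan_tan h.1 h.2]

/-- Within a quadrant around the vertex, angles are differences of arctangents, up to sign. -/
theorem signedAngle_eq_arctan_sub {p₁ p₂ σ τ b c b' c' : ℝ} (hσ : σ = 1 ∨ σ = -1)
    (hτ : τ = 1 ∨ τ = -1) (hb : 0 < b) (hc : 0 < c) (hb' : 0 < b') (hc' : 0 < c') :
    signedAngle (p₁ + σ * b, p₂ + τ * c) (p₁, p₂) (p₁ + σ * b', p₂ + τ * c') =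
      σ * τ * (Real.arctan (c' / b') - Real.arctan (c / b)) := by
  have hz : ∀ b c : ℝ, Complex.equivRealProd.symm (p₁ + σ * b, p₂ + τ * c) -
      Complex.equivRealProd.symm (p₁, p₂) = ⟨σ * b, τ * c⟩ := by
    intro b c
    apply Complex.ext <;> simp [Complex.equivRealProd_symm_apply]
  have hσ2 : σ * σ = 1 := by rcases hσ with rfl | rfl <;> norm_num
  have hτ2 : τ * τ = 1 := by rcases hτ with rfl | rfl <;> norm_num
  have hmul : (starRingEnd ℂ) ⟨σ * b, τ * c⟩ * (⟨σ * b', τ * c'⟩ : ℂ) =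
      ⟨b * b' + c * c', σ * τ * (b * c' - c * b')⟩ := by
    apply Complex.ext
    · simp only [Complex.mul_re, Complex.conj_re, Complex.conj_im]
      linear_combination b * b' * hσ2 + c * c' * hτ2
    · simp only [Complex.mul_im, Complex.conj_re, Complex.conj_im]
      ring
  have hpos : 0 < b * b' + c * c' := by positivity
  have htan : Real.arctan (c' / b') - Real.arctan (c / b) =
      Real.arctan ((b * c' - c * b') / (b * b' + c * c')) := by
    rw [sub_eq_add_neg, ← Real.arctan_neg, Real.arctan_add]
    · congr 1
      have : 1 - c' / b' * -(c / b) = (b * b' + c * c') / (b * b') := by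
        field_simp
        ring
      rw [this]
      field_simp
      ring
    · have : 0 < c' / b' * (c / b) := by positivity
      linarith
  rw [signedAngle, hz, hz, Complex.oangle, hmul, Complex.arg_coe_angle_toReal_eq_arg, htan,
    arg_eq_arctan hpos]
  rcases hσ with rfl | rfl <;> rcases hτ with rfl | rfl <;>
    simp [neg_div, ← Real.arctan_neg, -neg_sub]

/-- Exchanging the two rays absorbs the sign `σ * τ`. -/
theorem arctan_sub_mem_pinnedAngles {A : Finset ℝ} {p₁ p₂ σ τ b c b' c' : ℝ}
    (hσ : σ = 1 ∨ σ = -1) (hτ : τ = 1 ∨ τ = -1)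
    (hb : 0 < b) (hc : 0 < c) (hb' : 0 < b') (hc' : 0 < c')
    (hbA : p₁ + σ * b ∈ A) (hcA : p₂ + τ * c ∈ A) (hbA' : p₁ + σ * b' ∈ A)
    (hcA' : p₂ + τ * c' ∈ A) (hne : (b, c) ≠ (b', c')) :
    Real.arctan (c' / b') - Real.arctan (c / b) ∈ pinnedAngles (p₁, p₂) (A ×ˢ A) := by
  have hσ0 : σ ≠ 0 := by rcases hσ with rfl | rfl <;> norm_num
  have hτ0 : τ ≠ 0 := by rcases hτ with rfl | rfl <;> norm_num
  have hmem : ∀ b c : ℝ, 0 < b → p₁ + σ * b ∈ A → p₂ + τ * c ∈ A →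
      (p₁ + σ * b, p₂ + τ * c) ∈ (A ×ˢ A).erase (p₁, p₂) := by
    intro b c hb hbA hcA
    refine Finset.mem_erase.2 ⟨fun h => ?_, Finset.mem_product.2 ⟨hbA, hcA⟩⟩
    have : σ * b = 0 := by linarith [congrArg Prod.fst h]
    exact mul_ne_zero hσ0 hb.ne' this
  have hne' : (p₁ + σ * b, p₂ + τ * c) ≠ (p₁ + σ * b', p₂ + τ * c') := by
    intro h
    rw [Prod.mk.injEq, add_right_inj, add_right_inj, mul_right_inj' hσ0, mul_right_inj' hτ0] at h
    exact hne (Prod.ext h.1 h.2)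
  have hst : σ * τ = 1 ∨ σ * τ = -1 := by
    rcases hσ with rfl | rfl <;> rcases hτ with rfl | rfl <;> norm_num
  rcases hst with h | h
  · refine Finset.mem_image.2 ⟨((p₁ + σ * b, p₂ + τ * c), (p₁ + σ * b', p₂ + τ * c')),
      Finset.mem_offDiag.2 ⟨hmem b c hb hbA hcA, hmem b' c' hb' hbA' hcA', hne'⟩, ?_⟩
    rw [signedAngle_eq_arctan_sub hσ hτ hb hc hb' hc', h, one_mul]
  · refine Finset.mem_image.2 ⟨((p₁ + σ * b', p₂ + τ * c'), (p₁ + σ * b, p₂ + τ * c)),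
      Finset.mem_offDiag.2 ⟨hmem b' c' hb' hbA' hcA', hmem b c hb hbA hcA, hne'.symm⟩, ?_⟩
    rw [signedAngle_eq_arctan_sub hσ hτ hb' hc' hb hc, h]
    ring

theorem sum_mem_iteratedSumset_eight {S : Finset ℝ} {a b c d e : ℝ} (ha : a ∈ S) (hb : b ∈ S)
    (hc : c ∈ S) (hd : d ∈ S) (he : e ∈ S) : a + b + c + d + 4 * e ∈ iteratedSumset 8 S := by
  refine Finset.mem_image.2 ⟨![a, b, c, d, e, e, e, e], Fintype.mem_piFinset.2 fun i => ?_, ?_⟩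
  · fin_cases i <;> assumption
  · simp only [Fin.sum_univ_eight]
    simp
    ring

theorem exists_increasing_enumeration {X : Finset ℝ} {n : ℕ} (hX : X.card = n + 1) :
    ∃ x : ℕ → ℝ, (∀ i j, i < j → j ≤ n → x i < x j) ∧ ∀ i, x i ∈ X := by
  -- Clamping the index at `n` keeps every value in `X`.
  refine ⟨fun i => X.orderEmbOfFin hX ⟨min i n, by omega⟩, fun i j hij hj => ?_,
    fun i => Finset.orderEmbOfFin_mem X hX _⟩
  refine (X.orderEmbOfFin hX).strictMono (Fin.mk_lt_mk.2 ?_)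
  omega

/-- Eightfold sums of differences of the arctangents of the quotients of two separated sets. -/
theorem pow_three_le_card_iteratedSumset {m : ℕ} (hm : 0 < m) {S X Y : Finset ℝ}
    (hX : X.card = 4 * m + 1) (hY : Y.card = 4 * m + 1) (hpos : ∀ x ∈ X, 0 < x)
    (hXY : ∀ x ∈ X, ∀ y ∈ Y, x < y)
    (hS : ∀ x ∈ X, ∀ y ∈ Y, ∀ x' ∈ X, ∀ y' ∈ Y, (x, y) ≠ (x', y') →
      Real.arctan (y' / x') - Real.arctan (y / x) ∈ S) :
    m ^ 3 ≤ (iteratedSumset 8 S).card := by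
  obtain ⟨x, hx, hxX⟩ := exists_increasing_enumeration hX
  obtain ⟨y, hy, hyY⟩ := exists_increasing_enumeration hY
  set θ : ℕ → ℕ → ℝ := fun k i => Real.arctan (y i / x k) with hθ
  have hx0 : ∀ k, 0 < x k := fun k => hpos _ (hxX k)
  have hxy : ∀ k i, x k < y i := fun k i => hXY _ (hxX k) _ (hyY i)
  have hθS : ∀ k i k' i', x k ≠ x k' ∨ y i ≠ y i' → θ k' i' - θ k i ∈ S := by
    intro k i k' i' h
    refine hS _ (hxX k) _ (hyY i) _ (hxX k') _ (hyY i') fun he => ?_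
    rw [Prod.mk.injEq] at he
    rcases h with h | h
    · exact h he.1
    · exact h he.2
  have hystep : ∀ i < 4 * m, y i < y (i + 1) := fun i hi => hy i (i + 1) (Nat.lt_succ_self i) hi
  have hxstep : ∀ i < 4 * m, x i < x (i + 1) := fun i hi => hx i (i + 1) (Nat.lt_succ_self i) hi
  have hmono : ∀ (z : ℕ → ℝ), (∀ i j, i < j → j ≤ 4 * m → z i < z j) →
      ∀ i j, i < j → j ≤ 4 * m → z (i + 1) ≤ z j := by
    intro z hz i j hij hj
    rcases (Nat.succ_le_of_lt hij).eq_or_lt with h | h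
    · rw [← h]
    · exact (hz _ _ h hj).le
  have he : θ 0 1 - θ 0 0 ∈ S := hθS 0 0 0 1 (Or.inr (hystep 0 (by omega)).ne)
  -- The shift restores the base value `θ 0 0` and removes four copies of a padding angle.
  refine (pow_three_le_card_of_second_differences hm (θ := θ)
    (W := (iteratedSumset 8 S).image fun s => s + (θ 0 0 - 4 * (θ 0 1 - θ 0 0)))
    ?_ ?_ ?_ ?_).trans Finset.card_image_le
  · intro i j hij hj k _
    exact Real.arctan_strictMono (div_lt_div_of_pos_right (hy i j hij hj) (hx0 k))
  · intro k l hkl hl i hi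
    exact arctan_div_sub_lt (hx0 k) (hx k l hkl hl) (hxy l i) (hystep i hi)
  · intro i j hij hj k l hkl hl
    exact second_difference_arctan_ne (hx0 k) (hxstep k (hkl.trans hl)) (hmono x hx k l hkl hl.le)
      (hxstep l hl) (hxy _ _) (hystep i (hij.trans hj)) (hmono y hy i j hij hj.le) (hystep j hj)
  · intro j hj k hk i hi k' hk' i' hi'
    refine Finset.mem_image.2 ⟨_, sum_mem_iteratedSumset_eight
      (hθS 0 0 (4 * m) j (Or.inl (hx 0 (4 * m) (by omega) le_rfl).ne))
      (hθS k i k (i + 1) (Or.inr (hystep i hi).ne))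
      (hθS (k' + 1) i' (k' + 1) (i' + 1) (Or.inr (hystep i' hi').ne))
      (hθS k' (i' + 1) k' i' (Or.inr (hystep i' hi').ne')) he, ?_⟩
    ring

/-! ### Choosing the quadrant and the separated sets. -/

theorem exists_half_around (A : Finset ℝ) (p : ℝ) :
    ∃ σ : ℝ, (σ = 1 ∨ σ = -1) ∧ ∃ B : Finset ℝ, (∀ b ∈ B, 0 < b ∧ p + σ * b ∈ A) ∧
      A.card ≤ 2 * B.card + 1 := by
  classical
  have h1 := Finset.card_filter_add_card_filter_not (s := A) (fun a => p < a)
  have h2 : (A.filter fun a => ¬ p < a).card ≤ (A.filter fun a => a < p).card + 1 := by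
    refine (Finset.card_le_card ?_).trans (Finset.card_insert_le p _)
    intro a ha
    obtain ⟨haA, ha⟩ := Finset.mem_filter.1 ha
    rcases (not_lt.1 ha).eq_or_lt with h | h
    · exact Finset.mem_insert.2 (Or.inl h)
    · exact Finset.mem_insert_of_mem (Finset.mem_filter.2 ⟨haA, h⟩)
  rcases le_total (A.filter fun a => a < p).card (A.filter fun a => p < a).card with h | h
  · refine ⟨1, Or.inl rfl, (A.filter fun a => p < a).image fun a => a - p, ?_, ?_⟩
    · intro b hb
      obtain ⟨a, ha, rfl⟩ := Finset.mem_image.1 hb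
      obtain ⟨haA, ha⟩ := Finset.mem_filter.1 ha
      exact ⟨sub_pos.2 ha, by simpa using haA⟩
    · rw [Finset.card_image_of_injective _ sub_left_injective]
      omega
  · refine ⟨-1, Or.inr rfl, (A.filter fun a => a < p).image fun a => p - a, ?_, ?_⟩
    · intro b hb
      obtain ⟨a, ha, rfl⟩ := Finset.mem_image.1 hb
      obtain ⟨haA, ha⟩ := Finset.mem_filter.1 ha
      exact ⟨sub_pos.2 ha, by simpa using haA⟩
    · rw [Finset.card_image_of_injective _ sub_right_injective]
      omega

/-- The lower half of the set with the smaller median lies below the upper half of the other;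
discarding the median makes this strict, whence `q + 1`. -/
theorem exists_separated_subsets {q : ℕ} {B C : Finset ℝ} (hB : 2 * (q + 1) ≤ B.card)
    (hC : 2 * (q + 1) ≤ C.card) :
    ∃ X ⊆ B, ∃ Y ⊆ C, X.card = q ∧ Y.card = q ∧
      ((∀ x ∈ X, ∀ y ∈ Y, x < y) ∨ ∀ y ∈ Y, ∀ x ∈ X, y < x) := by
  classical
  obtain ⟨B', hB', hBc⟩ := Finset.exists_subset_card_eq hB
  obtain ⟨C', hC', hCc⟩ := Finset.exists_subset_card_eq hC
  obtain ⟨μ, hμ, hμ'⟩ := exists_median B' id q.succ_pos hBc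
  obtain ⟨ν, hν, hν'⟩ := exists_median C' id q.succ_pos hCc
  have aux : ∀ (P Q : Finset ℝ) (s t : ℝ), q + 1 ≤ (P.filter fun i => i ≤ s).card →
      q + 1 ≤ (Q.filter fun i => t ≤ i).card → s ≤ t →
      ∃ X ⊆ P, ∃ Y ⊆ Q, X.card = q ∧ Y.card = q ∧ ∀ x ∈ X, ∀ y ∈ Y, x < y := by
    intro P Q s t hP hQ hst
    have hP' : q ≤ ((P.filter fun i => i ≤ s).erase s).card := by
      have := Finset.pred_card_le_card_erase (s := P.filter fun i => i ≤ s) (a := s)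
      omega
    obtain ⟨X, hX, hXc⟩ := Finset.exists_subset_card_eq hP'
    obtain ⟨Y, hY, hYc⟩ := Finset.exists_subset_card_eq ((Nat.le_succ q).trans hQ)
    refine ⟨X, fun x hx => (Finset.mem_filter.1 (Finset.mem_of_mem_erase (hX hx))).1, Y,
      fun y hy => (Finset.mem_filter.1 (hY hy)).1, hXc, hYc, fun x hx y hy => ?_⟩
    obtain ⟨hne, hx⟩ := Finset.mem_erase.1 (hX hx)
    exact ((Finset.mem_filter.1 hx).2.lt_of_ne hne).trans_le
      (hst.trans (Finset.mem_filter.1 (hY hy)).2)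
  rcases le_total μ ν with h | h
  · obtain ⟨X, hX, Y, hY, hXc, hYc, hlt⟩ := aux B' C' μ ν hμ hν' h
    exact ⟨X, hX.trans hB', Y, hY.trans hC', hXc, hYc, Or.inl hlt⟩
  · obtain ⟨Y, hY, X, hX, hYc, hXc, hlt⟩ := aux C' B' ν μ hν hμ' h
    exact ⟨X, hX.trans hB', Y, hY.trans hC', hXc, hYc, Or.inr hlt⟩

theorem pow_three_le_card_iteratedSumset_pinnedAngles {A : Finset ℝ} {m : ℕ} (hm : 0 < m)
    (hA : 16 * m + 9 ≤ A.card) (p : ℝ × ℝ) :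
    m ^ 3 ≤ (iteratedSumset 8 (pinnedAngles p (A ×ˢ A))).card := by
  obtain ⟨p₁, p₂⟩ := p
  obtain ⟨σ, hσ, B, hB, hBc⟩ := exists_half_around A p₁
  obtain ⟨τ, hτ, C, hC, hCc⟩ := exists_half_around A p₂
  obtain ⟨X, hXB, Y, hYC, hX, hY, hlt | hlt⟩ :=
    exists_separated_subsets (q := 4 * m + 1) (B := B) (C := C) (by omega) (by omega)
  · refine pow_three_le_card_iteratedSumset hm hX hY (fun x hx => (hB x (hXB hx)).1) hlt ?_
    intro x hx y hy x' hx' y' hy' hne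
    have h1 := hB x (hXB hx)
    have h2 := hC y (hYC hy)
    have h3 := hB x' (hXB hx')
    have h4 := hC y' (hYC hy')
    exact arctan_sub_mem_pinnedAngles hσ hτ h1.1 h2.1 h3.1 h4.1 h1.2 h2.2 h3.2 h4.2 hne
  · refine pow_three_le_card_iteratedSumset hm hY hX (fun y hy => (hC y (hYC hy)).1) hlt ?_
    intro y hy x hx y' hy' x' hx' hne
    have h1 := hB x (hXB hx)
    have h2 := hC y (hYC hy)
    have h3 := hB x' (hXB hx')
    have h4 := hC y' (hYC hy')
    have h := arctan_sub_mem_pinnedAngles hσ hτ h3.1 h4.1 h1.1 h2.1 h3.2 h4.2 h1.2 h2.2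
      (fun h => hne (Prod.ext (Prod.ext_iff.1 h).2.symm (Prod.ext_iff.1 h).1.symm))
    -- Swapping axes replaces `arctan` by `π / 2 - arctan`; the constants cancel and the rays trade
    -- places.
    rw [← inv_div y x, ← inv_div y' x', Real.arctan_inv_of_pos (div_pos h2.1 h1.1),
      Real.arctan_inv_of_pos (div_pos h4.1 h3.1)]
    convert h using 1
    ring

theorem iteratedSumset_pinnedAngles_nonempty {A : Finset ℝ} (hA : 2 ≤ A.card) (p : ℝ × ℝ) :
    (iteratedSumset 8 (pinnedAngles p (A ×ˢ A))).Nonempty := by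
  have h1 : 1 < ((A ×ˢ A).erase p).card := by
    have := Finset.pred_card_le_card_erase (s := A ×ˢ A) (a := p)
    rw [Finset.card_product] at this
    have : 4 ≤ A.card * A.card := Nat.mul_le_mul hA hA
    omega
  obtain ⟨q, hq, r, hr, hqr⟩ := Finset.one_lt_card.1 h1
  have h : signedAngle q p r ∈ pinnedAngles p (A ×ˢ A) :=
    Finset.mem_image.2 ⟨(q, r), Finset.mem_offDiag.2 ⟨hq, hr, hqr⟩, rfl⟩
  exact ⟨_, sum_mem_iteratedSumset_eight h h h h h⟩

end

theorem corollary1p9 :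
    ∃ c : ℝ, 0 < c ∧
      ∀ A : Finset ℝ, 2 ≤ A.card → ∀ p ∈ A ×ˢ A,
        c * (A.card : ℝ) ^ (13 / 5 : ℝ) ≤
          ((iteratedSumset 8 (pinnedAngles p (A ×ˢ A))).card : ℝ) := by
  -- For `N = A.card ≥ 25`, `m = (N - 9) / 16` is positive and `N ≤ 40 * m`, with equality at `N =
  -- 40`.
  refine ⟨1 / 40 ^ 3, by norm_num, fun A hA p _ => ?_⟩
  have h1 : (A.card : ℝ) ^ (13 / 5 : ℝ) ≤ (A.card : ℝ) ^ 3 := by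
    rw [← Real.rpow_natCast]
    exact Real.rpow_le_rpow_of_exponent_le (by exact_mod_cast (by omega : 1 ≤ A.card))
      (by norm_num)
  suffices h : A.card ^ 3 ≤ 40 ^ 3 * (iteratedSumset 8 (pinnedAngles p (A ×ˢ A))).card by
    have h' : (A.card : ℝ) ^ 3 ≤
        40 ^ 3 * ((iteratedSumset 8 (pinnedAngles p (A ×ˢ A))).card : ℝ) := by exact_mod_cast h
    linarith
  rcases lt_or_ge A.card 25 with hlt | hge
  · have h2 := Finset.card_pos.2 (iteratedSumset_pinnedAngles_nonempty hA p)
    calc A.card ^ 3 ≤ 40 ^ 3 := Nat.pow_le_pow_left (by omega) 3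
      _ ≤ _ := Nat.le_mul_of_pos_right _ h2
  · have h2 := pow_three_le_card_iteratedSumset_pinnedAngles (A := A) (m := (A.card - 9) / 16)
      (by omega) (by omega) p
    calc A.card ^ 3 ≤ (40 * ((A.card - 9) / 16)) ^ 3 := Nat.pow_le_pow_left (by omega) 3
      _ = 40 ^ 3 * ((A.card - 9) / 16) ^ 3 := mul_pow _ _ _
      _ ≤ _ := Nat.mul_le_mul_left _ h2
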